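/- Let $d\ge 1$ be an integer and $R>0$ a real number, both fixed, and put $s:=\lfloor R\rfloor+1$. For $n\ge 1$ let $\xi_1,\dots,\xi_n$ be independent random signs, $\mathbf P(\xi_i=1)=\mathbf P(\xi_i=-1)=1/2$, and let $$p(d,R,\mathrm{Ber},n):=\sup_{a_1,\dots,a_n}\ \sup_{x\in\mathbb R^d}\ \mathbf P\big(a_1\xi_1+\dots+a_n\xi_n\in \overline B(x,R)\big),$$ where $a_1,\dots,a_n$ range over all (not necessarily distinct) vectors of Euclidean norm at least $1$ in $\mathbb R^d$ and $\overline B(x,R)$ is the closed ball of radius $R$ centered at $x$. Let $S(n,m)$ denote the sum of the $m$ largest binomial coefficients $\binom ni$, $0\le i\le n$ (of all of them if $m>n+1$). Then, as $n\to\infty$, $$p(d,R,\mathrm{Ber},n)=(1+o(1))\,2^{-n}S(n,s).$$ If $R$ is not an integer, the same asymptotic formula holds when open balls $B(x,R)$ are used in place of closed balls in the definition of $p(d,R,\mathrm{Ber},n)$. -/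

import Mathlib

open MeasureTheory Filter Asymptotics
open scoped ENNReal

namespace LittlewoodOfford

/-- The law of a random sign: the values `1` and `-1` with probability `1/2` each. -/
noncomputable def Ber : Measure ℝ :=
  (2⁻¹ : ℝ≥0∞) • Measure.dirac 1 + (2⁻¹ : ℝ≥0∞) • Measure.dirac (-1)

instance : IsProbabilityMeasure Ber := ⟨by simp [Ber, ENNReal.inv_two_add_inv_two]⟩

/-- The small ball probability `sup_x ℙ (a₁ ξ₁ + ⋯ + aₙ ξₙ ∈ B x R)`, where `ξ₁, …, ξₙ` are
independent with law `ξ` (so that their joint law is the product measure) and the argument `B`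
is `Metric.ball` or `Metric.closedBall`. -/
noncomputable def smallBallProb {d n : ℕ}
    (B : EuclideanSpace ℝ (Fin d) → ℝ → Set (EuclideanSpace ℝ (Fin d)))
    (R : ℝ) (ξ : Measure ℝ) (a : Fin n → EuclideanSpace ℝ (Fin d)) : ℝ≥0∞ :=
  ⨆ x : EuclideanSpace ℝ (Fin d),
    Measure.pi (fun _ : Fin n => ξ) {t | ∑ i, t i • a i ∈ B x R}

/-- The supremum of the small ball probabilities over all families of `n` vectors of norm at
least `1` in `ℝ^d`. -/
noncomputable def maxSmallBallProb (d : ℕ)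
    (B : EuclideanSpace ℝ (Fin d) → ℝ → Set (EuclideanSpace ℝ (Fin d)))
    (R : ℝ) (ξ : Measure ℝ) (n : ℕ) : ℝ≥0∞ :=
  ⨆ (a : Fin n → EuclideanSpace ℝ (Fin d)) (_ : ∀ i, 1 ≤ ‖a i‖), smallBallProb B R ξ a

/-- `S(n, m)`, the sum of the `m` largest binomial coefficients `n.choose i`, `0 ≤ i ≤ n`
(of all of them if `m > n + 1`): the largest sum over at most `m` of the indices. -/
def sumLargestChoose (n m : ℕ) : ℕ :=
  ((Finset.range (n + 1)).powerset.filter (fun I => I.card ≤ m)).sup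
    (fun I => ∑ i ∈ I, n.choose i)

end LittlewoodOfford

/-! Write `midProb n` for the central binomial probability, of order `n ^ (-1/2)`, and `s = ⌊R⌋₊ +
1`. Both sides of the claimed equivalence are shown to be equivalent to `s * midProb n` by the
sandwich `isEquivalent_midProb`.

The lower bound comes from equal unit vectors: the `s` sums with `n / 2, …, n / 2 + s - 1` plus
signs lie on a segment of half-length `s - 1 = ⌊R⌋₊` (`sum_choose_le_signCount`).

For the upper bound, cut space into finitely many narrow cones and let `v` be the axis of the most
popular one. Let `K` be the number of vectors nearly parallel to `± v`. Projecting to `v` and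
applying the Erdős bound gives at most `s * midProb K`, which suffices when `K` is close to `n`.
Otherwise linearly many vectors are far from `± v`, so another cone, well separated from `± v`, is
also popular. A two-part Sperner argument then bounds the probability by a constant times `midProb k
* midProb l` with `k` and `l` linear in `n`; this is `O(1/n)`, hence negligible. The dichotomy is
`exists_signCount_closedBall_le_or`; `eventually_signCount_closedBall_le` draws the conclusion. -/

namespace LittlewoodOfford

/-! ### Sperner-type bounds for families of finite sets. -/

section Combinatorics

open Finset

variable {ι : Type*} [Fintype ι] [DecidableEq ι]

/-- A family indexed by subsets of `X` contains at most `B * (card X).choose (card X / 2)` members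
if every maximal chain of subsets meets it at most `B` times. -/
lemma card_le_mul_choose_of_isPrefix {X β : Type*} [Fintype X] [DecidableEq X]
    (𝒜 : Finset β) (g : β → Finset X) (B : ℕ)
    (h : ∀ f : Numbering X, #{S ∈ 𝒜 | f ∈ Numbering.prefixed (g S)} ≤ B) :
    #𝒜 ≤ B * (Fintype.card X).choose (Fintype.card X / 2) := by
  set m := Fintype.card X
  have key : ∑ f : Numbering X, #{S ∈ 𝒜 | f ∈ Numbering.prefixed (g S)}
      = ∑ S ∈ 𝒜, #(Numbering.prefixed (g S)) := by
    have := sum_card_bipartiteAbove_eq_sum_card_bipartiteBelow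
      (s := (univ : Finset (Numbering X))) (t := 𝒜)
      (fun f S => f ∈ Numbering.prefixed (g S))
    simpa [bipartiteAbove, bipartiteBelow, Numbering.prefixed] using this
  have h1 : ∑ f : Numbering X, #{S ∈ 𝒜 | f ∈ Numbering.prefixed (g S)} ≤ m.factorial * B := by
    refine (sum_le_card_nsmul univ _ B fun f _ => h f).trans ?_
    simp [m, Fintype.card_numbering]
  -- LYM weights: a set of size `k` is a prefix of `k! * (m - k)!` numberings, which is at least
  -- `m!` divided by the middle binomial coefficient.
  have h2 : #𝒜 * m.factorial ≤ ∑ S ∈ 𝒜, #(Numbering.prefixed (g S)) * m.choose (m / 2) := by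
    rw [← smul_eq_mul, ← sum_const]
    refine sum_le_sum fun S _ => ?_
    rw [Numbering.card_prefixed, ← Nat.choose_mul_factorial_mul_factorial (card_le_univ (g S)),
      mul_assoc, mul_comm]
    exact Nat.mul_le_mul_left _ (Nat.choose_le_middle _ _)
  rw [← sum_mul, ← key] at h2
  refine Nat.le_of_mul_le_mul_right (h2.trans ?_) m.factorial_pos
  calc _ ≤ m.factorial * B * m.choose (m / 2) := Nat.mul_le_mul_right _ h1
    _ = _ := by ring

/-- Sperner's theorem for the traces on `I`, fibred over the traces on the complement of `L`. -/
lemma card_le_of_fiberwise_antichain (𝒜 : Finset (Finset ι)) (I L : Finset ι)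
    (h : ∀ S ∈ 𝒜, ∀ S' ∈ 𝒜, S \ L = S' \ L → S ∩ I ⊆ S' ∩ I → S = S') :
    #𝒜 ≤ (#I).choose (#I / 2) * 2 ^ (Fintype.card ι - #L) := by
  rw [← card_compl, ← card_powerset]
  refine card_le_mul_card_image_of_maps_to (f := fun S => S \ L) (fun S _ => ?_) _ fun W _ => ?_
  · simp only [mem_powerset]
    intro x hx
    simp at hx ⊢
    exact hx.2
  · have hsub : ∀ S S' : Finset ι, S.subtype (· ∈ I) ⊆ S'.subtype (· ∈ I) → S ∩ I ⊆ S' ∩ I := by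
      intro S S' hSS x hx
      rw [mem_inter] at hx ⊢
      have := @hSS ⟨x, hx.2⟩ (by simpa using hx.1)
      exact ⟨by simpa using this, hx.2⟩
    have hinj : Set.InjOn (fun S : Finset ι => S.subtype (· ∈ I)) ({S ∈ 𝒜 | S \ L = W} : Finset _) := by
      intro S hS S' hS' hSS
      simp only [coe_filter, Set.mem_ofPred_eq] at hS hS'
      exact h S hS.1 S' hS'.1 (hS.2.trans hS'.2.symm) (hsub _ _ hSS.subset)
    rw [← card_image_of_injOn hinj]
    have hanti : IsAntichain (· ⊆ ·)
        (SetLike.coe (image (fun S : Finset ι => S.subtype (· ∈ I)) {S ∈ 𝒜 | S \ L = W})) := by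
      intro T hT T' hT' hne hTT
      simp only [coe_image, coe_filter, Set.mem_image, Set.mem_ofPred_eq] at hT hT'
      obtain ⟨S, hS, rfl⟩ := hT
      obtain ⟨S', hS', rfl⟩ := hT'
      exact hne (by rw [h S hS.1 S' hS'.1 (hS.2.trans hS'.2.symm) (hsub _ _ hTT)])
    simpa using hanti.sperner

/-- A two-part Sperner theorem. -/
lemma card_le_of_two_part_antichain (𝒜 : Finset (Finset ι)) (I J : Finset ι) (hIJ : Disjoint I J)
    (h : ∀ S ∈ 𝒜, ∀ S' ∈ 𝒜, S \ (I ∪ J) = S' \ (I ∪ J) → S ∩ I ⊆ S' ∩ I →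
      (S ∩ J ⊆ S' ∩ J ∨ S' ∩ J ⊆ S ∩ J) → S = S') :
    #𝒜 ≤ (#I).choose (#I / 2) * (#J).choose (#J / 2) * 2 ^ (Fintype.card ι - (#I + #J)) := by
  rw [mul_right_comm, ← card_union_of_disjoint hIJ]
  have := card_le_mul_choose_of_isPrefix (X := J) 𝒜 (fun S => S.subtype (· ∈ J))
    ((#I).choose (#I / 2) * 2 ^ (Fintype.card ι - #(I ∪ J))) ?_
  · simpa using this
  intro f
  -- Prefixes of one numbering `f` of `J` are pairwise comparable, so among the sets kept for `f`
  -- the hypothesis makes the traces on `I` an antichain within each fibre.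
  refine card_le_of_fiberwise_antichain _ I (I ∪ J) ?_
  intro S hS S' hS' he hI
  simp only [mem_filter, Numbering.mem_prefixed] at hS hS'
  refine h S hS.1 S' hS'.1 he hI ?_
  have hsub : ∀ S S' : Finset ι, S.subtype (· ∈ J) ⊆ S'.subtype (· ∈ J) → S ∩ J ⊆ S' ∩ J := by
    intro S S' hSS x hx
    rw [mem_inter] at hx ⊢
    have := @hSS ⟨x, hx.2⟩ (by simpa using hx.1)
    exact ⟨by simpa using this, hx.2⟩
  rcases le_total (#(S.subtype (· ∈ J))) (#(S'.subtype (· ∈ J))) with hc | hc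
  · exact Or.inl (hsub _ _ (hS.2.subset_of_card_le_card hS'.2 hc))
  · exact Or.inr (hsub _ _ (hS'.2.subset_of_card_le_card hS.2 hc))

end Combinatorics

/-! ### Counting signed sums; the one-dimensional bound. -/

section SignedSums

open Finset

variable {ι E : Type*} [Fintype ι] [DecidableEq ι] [NormedAddCommGroup E]

/-- The sum of the vectors `± a i`, with the sign `+` exactly at the indices in `S`. -/
def signedSum (a : ι → E) (S : Finset ι) : E :=
  ∑ i, if i ∈ S then a i else -a i

open Classical in
/-- The number of choices of signs for which the signed sum of the vectors `a i` lies in `B`. -/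
noncomputable def signCount (a : ι → E) (B : Set E) : ℕ :=
  #{S : Finset ι | signedSum a S ∈ B}

lemma signedSum_sub (a : ι → E) (S S' : Finset ι) :
    signedSum a S' - signedSum a S =
      (∑ i ∈ S' \ S, a i - ∑ i ∈ S \ S', a i) + (∑ i ∈ S' \ S, a i - ∑ i ∈ S \ S', a i) := by
  have h (T U : Finset ι) : ∑ i ∈ T \ U, a i = ∑ i, if i ∈ T \ U then a i else 0 := by
    rw [sum_ite_mem, univ_inter]
  rw [signedSum, signedSum, h, h, ← sum_sub_distrib, ← sum_sub_distrib, ← sum_add_distrib]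
  refine sum_congr rfl fun i _ => ?_
  by_cases h1 : i ∈ S <;> by_cases h2 : i ∈ S' <;> simp [h1, h2, sub_eq_add_neg]

lemma signedSum_flip (a : ι → E) (F S : Finset ι) :
    signedSum (fun i => if i ∈ F then -a i else a i) S = signedSum a (symmDiff S F) := by
  refine sum_congr rfl fun i _ => ?_
  by_cases h1 : i ∈ S <;> by_cases h2 : i ∈ F <;> simp [h1, h2, mem_symmDiff]

/-- Negating some of the vectors only permutes the sign choices, so real coefficients may be assumed
nonnegative. -/
lemma signCount_flip (a : ι → E) (F : Finset ι) (B : Set E) :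
    signCount (fun i => if i ∈ F then -a i else a i) B = signCount a B := by
  classical
  refine card_nbij' (fun S => symmDiff S F) (fun S => symmDiff S F) ?_ ?_ ?_ ?_
  · intro S hS
    simpa [← signedSum_flip] using hS
  · intro S hS
    simp only [coe_filter, mem_univ, true_and, Set.mem_ofPred_eq, signedSum_flip] at hS ⊢
    simpa using hS
  · intro S _; simp
  · intro S _; simp

lemma signCount_mono (a : ι → E) {B B' : Set E} (h : B ⊆ B') : signCount a B ≤ signCount a B' := by
  classical
  exact card_le_card fun S hS => by
    simp only [mem_filter, mem_univ, true_and] at hS ⊢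
    exact h hS

lemma signCount_iUnion_le {κ : Type*} (a : ι → E) (T : Finset κ) (C : κ → Set E) {B : Set E}
    (h : B ⊆ ⋃ z ∈ T, C z) : signCount a B ≤ ∑ z ∈ T, signCount a (C z) := by
  classical
  refine (card_le_card (t := T.biUnion fun z => {S | signedSum a S ∈ C z}) fun S hS => ?_).trans
    card_biUnion_le
  have := h (by simpa using hS)
  simpa using this

/-- Enlarging `S` inside `I` raises the sum by at least `2 * c`, too much for a half-open interval
of that length; hence the traces on `I` form an antichain once the other signs are fixed. -/
lemma signCount_Ico_le_of_pos (b : ι → ℝ) (I : Finset ι) {c y : ℝ}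
    (hb : ∀ i ∈ I, c ≤ b i) (hc : 0 < c) :
    signCount b (Set.Ico y (y + 2 * c)) ≤ (#I).choose (#I / 2) * 2 ^ (Fintype.card ι - #I) := by
  classical
  unfold signCount
  convert card_le_of_fiberwise_antichain _ I I ?_
  intro S hS S' hS' he hI
  simp only [mem_filter, mem_univ, true_and, Set.mem_Ico] at hS hS'
  have hmem : ∀ x, x ∉ I → (x ∈ S ↔ x ∈ S') := fun x hx => by
    have := congrArg (x ∈ ·) he
    simpa [hx] using this
  have hsub : S ⊆ S' := fun x hx => by
    by_cases hxI : x ∈ I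
    · exact (mem_inter.1 (hI (mem_inter.2 ⟨hx, hxI⟩))).1
    · exact (hmem x hxI).1 hx
  by_contra hne
  obtain ⟨x, hxS', hxS⟩ : ∃ x ∈ S', x ∉ S := by
    by_contra! hcon
    exact hne (hsub.antisymm hcon)
  have hdiff : ∀ i ∈ S' \ S, c ≤ b i := fun i hi => by
    rw [Finset.mem_sdiff] at hi
    refine hb i ?_
    by_contra hiI
    exact hi.2 ((hmem i hiI).2 hi.1)
  have h1 := signedSum_sub b S S'
  rw [sdiff_eq_empty_iff_subset.2 hsub] at h1
  have h2 : c ≤ ∑ i ∈ S' \ S, b i :=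
    (hdiff x (by simp [hxS', hxS])).trans (single_le_sum (f := b)
      (fun i hi => hc.le.trans (hdiff i hi)) (by simp [hxS', hxS]))
  simp only [sum_empty, sub_zero] at h1
  linarith [hS.1, hS'.2]

/-- The one-dimensional Littlewood–Offord bound of Erdős. -/
lemma signCount_Icc_le (b : ι → ℝ) (I : Finset ι) {c r y : ℝ} {s : ℕ}
    (hb : ∀ i ∈ I, c ≤ |b i|) (hc : 0 < c) (hr : r < c * s) :
    signCount b (Set.Icc (y - r) (y + r)) ≤
      s * ((#I).choose (#I / 2) * 2 ^ (Fintype.card ι - #I)) := by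
  classical
  rw [← signCount_flip b {i | b i < 0}]
  -- The interval has length `2 * r < s * (2 * c)`, so `s` half-open intervals of length `2 * c`
  -- cover it.
  refine (signCount_iUnion_le _ (range s)
    (fun j => Set.Ico (y - r + j * (2 * c)) (y - r + j * (2 * c) + 2 * c)) ?_).trans
    ((sum_le_card_nsmul (range s) _ _ fun j _ =>
      signCount_Ico_le_of_pos _ I (c := c) (fun i hi => ?_) hc).trans ?_)
  · intro z hz
    have h0 : 0 ≤ (z - (y - r)) / (2 * c) := div_nonneg (by linarith [hz.1]) (by linarith)
    simp only [Set.mem_iUnion, mem_range, exists_prop, Set.mem_Ico]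
    refine ⟨⌊(z - (y - r)) / (2 * c)⌋₊, ?_, ?_, ?_⟩
    · rw [Nat.floor_lt h0, div_lt_iff₀ (by linarith)]
      linarith [hz.2]
    · have := Nat.floor_le h0
      rw [le_div_iff₀ (by linarith)] at this
      linarith
    · have := Nat.lt_floor_add_one ((z - (y - r)) / (2 * c))
      rw [div_lt_iff₀ (by linarith)] at this
      linarith
  · have := hb i hi
    by_cases h : b i < 0
    · simpa [h, abs_of_neg h] using this
    · simpa [h, abs_of_nonneg (not_lt.1 h)] using this
  · simp

end SignedSums

/-! ### Vectors in two separated cones. -/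

section Cones

open Finset

variable {ι E : Type*} [NormedAddCommGroup E] [InnerProductSpace ℝ E]

lemma norm_sum_sub_smul_le (a : ι → E) (P : Finset ι) {u : E} {ρ : ℝ}
    (h : ∀ i ∈ P, ‖a i - ‖a i‖ • u‖ ≤ ρ * ‖a i‖) :
    ‖∑ i ∈ P, a i - (∑ i ∈ P, ‖a i‖) • u‖ ≤ ρ * ∑ i ∈ P, ‖a i‖ := by
  rw [sum_smul, ← sum_sub_distrib, mul_sum]
  exact (norm_sum_le _ _).trans (sum_le_sum h)

/-- The squared norm is at least `(|X| - |Y|) ^ 2 + 6 * ρ * |X| * |Y|`, because `u` is close to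
neither `v` nor `-v`; the signs of `X` and `Y` therefore do not matter. -/
lemma le_norm_smul_add_smul {u v : E} {ρ : ℝ} (hu : ‖u‖ = 1) (hv : ‖v‖ = 1) (hρ : 0 ≤ ρ)
    (hρ' : ρ ≤ 1 / 4) (huv : |inner ℝ u v| ≤ 1 - 3 * ρ) (X Y : ℝ) :
    2 * ρ * (|X| + |Y|) ≤ ‖X • u + Y • v‖ := by
  refine le_of_sq_le_sq ?_ (norm_nonneg _)
  rw [norm_add_sq_real, norm_smul, norm_smul, hu, hv, inner_smul_left, inner_smul_right]
  simp only [Real.norm_eq_abs, mul_one, RCLike.conj_to_real]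
  have h1 : -(|X| * |Y| * (1 - 3 * ρ)) ≤ X * (Y * inner ℝ u v) := by
    have : |X * (Y * inner ℝ u v)| ≤ |X| * |Y| * (1 - 3 * ρ) := by
      rw [abs_mul, abs_mul, ← mul_assoc]
      gcongr
    linarith [neg_abs_le (X * (Y * inner ℝ u v))]
  have hXY : 0 ≤ |X| * |Y| := by positivity
  nlinarith [mul_nonneg (sub_nonneg.2 hρ') (sq_nonneg (|X| - |Y|)),
    mul_nonneg hρ (sub_nonneg.2 hρ'), mul_nonneg (mul_nonneg hρ (sub_nonneg.2 hρ')) hXY,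
    mul_nonneg (mul_nonneg hρ (sub_nonneg.2 hρ')) (sq_nonneg (|X| - |Y|)),
    sq_nonneg (|X| - |Y|), mul_nonneg hρ hXY]

/-- Replacing each vector by its component along the cone axis costs a fraction `ρ` of the total
length, so the constant `2 * ρ` for the axes drops to `ρ`. -/
lemma le_norm_sum_add_smul_sum (a : ι → E) (P Q : Finset ι) {u v : E} {ρ τ : ℝ}
    (hu : ‖u‖ = 1) (hv : ‖v‖ = 1) (hρ : 0 ≤ ρ) (hρ' : ρ ≤ 1 / 4)
    (huv : |inner ℝ u v| ≤ 1 - 3 * ρ) (hτ : |τ| = 1)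
    (hP : ∀ i ∈ P, ‖a i - ‖a i‖ • u‖ ≤ ρ * ‖a i‖)
    (hQ : ∀ i ∈ Q, ‖a i - ‖a i‖ • v‖ ≤ ρ * ‖a i‖) :
    ρ * (∑ i ∈ P, ‖a i‖ + ∑ i ∈ Q, ‖a i‖) ≤ ‖∑ i ∈ P, a i + τ • ∑ i ∈ Q, a i‖ := by
  have h1 := norm_sum_sub_smul_le a P hP
  have h2 := norm_sum_sub_smul_le a Q hQ
  have hX : 0 ≤ ∑ i ∈ P, ‖a i‖ := sum_nonneg fun i _ => norm_nonneg _
  have hY : 0 ≤ ∑ i ∈ Q, ‖a i‖ := sum_nonneg fun i _ => norm_nonneg _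
  have h3 := le_norm_smul_add_smul hu hv hρ hρ' huv (∑ i ∈ P, ‖a i‖) (τ * ∑ i ∈ Q, ‖a i‖)
  rw [abs_mul, hτ, one_mul, abs_of_nonneg hX, abs_of_nonneg hY] at h3
  have h4 : ‖τ • (∑ i ∈ Q, a i - (∑ i ∈ Q, ‖a i‖) • v)‖ ≤ ρ * ∑ i ∈ Q, ‖a i‖ := by
    rwa [norm_smul, Real.norm_eq_abs, hτ, one_mul]
  set x := ∑ i ∈ P, a i
  set y := ∑ i ∈ Q, a i
  set X := ∑ i ∈ P, ‖a i‖
  set Y := ∑ i ∈ Q, ‖a i‖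
  have h5 : X • u + (τ * Y) • v = (x + τ • y) - ((x - X • u) + τ • (y - Y • v)) := by
    rw [smul_sub, mul_smul]; abel
  rw [h5] at h3
  have h6 := norm_sub_le (x + τ • y) ((x - X • u) + τ • (y - Y • v))
  have h7 := norm_add_le (x - X • u) (τ • (y - Y • v))
  linarith

variable [Fintype ι] [DecidableEq ι]

/-- If the vectors indexed by `I` and by `J` lie in two well separated narrow cones, then a small
ball contains few of the signed sums. -/
lemma signCount_ball_le_of_cones (a : ι → E) (I J : Finset ι) (hIJ : Disjoint I J) {u v : E} {ρ : ℝ}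
    (hu : ‖u‖ = 1) (hv : ‖v‖ = 1) (hρ : 0 < ρ) (hρ' : ρ ≤ 1 / 4)
    (huv : |inner ℝ u v| ≤ 1 - 3 * ρ) (ha : ∀ i, 1 ≤ ‖a i‖)
    (hI : ∀ i ∈ I, ‖a i - ‖a i‖ • u‖ ≤ ρ * ‖a i‖)
    (hJ : ∀ i ∈ J, ‖a i - ‖a i‖ • v‖ ≤ ρ * ‖a i‖) (z : E) :
    signCount a (Metric.ball z ρ) ≤
      (#I).choose (#I / 2) * (#J).choose (#J / 2) * 2 ^ (Fintype.card ι - (#I + #J)) := by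
  classical
  unfold signCount
  convert card_le_of_two_part_antichain _ I J hIJ ?_
  intro S hS S' hS' he hSI hSJ
  simp only [mem_filter, mem_univ, true_and, Metric.mem_ball] at hS hS'
  have hdist : ‖signedSum a S' - signedSum a S‖ < 2 * ρ := by
    rw [← dist_eq_norm]
    linarith [dist_triangle_right (signedSum a S') (signedSum a S) z]
  have hmem : ∀ x, x ∉ I → x ∉ J → (x ∈ S ↔ x ∈ S') := fun x hx hx' => by
    have := congrArg (x ∈ ·) he
    simpa [hx, hx'] using this
  have hmI : ∀ x ∈ I, x ∈ S → x ∈ S' := fun x hx hxS =>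
    (mem_inter.1 (hSI (mem_inter.2 ⟨hxS, hx⟩))).1
  have hsum : ∀ (P Q : Finset ι) (τ : ℝ), P ⊆ I → Q ⊆ J → |τ| = 1 →
      signedSum a S' - signedSum a S = (2 : ℝ) • (∑ i ∈ P, a i + τ • ∑ i ∈ Q, a i) →
      P = ∅ ∧ Q = ∅ := by
    intro P Q τ hP hQ hτ heq
    have h1 := le_norm_sum_add_smul_sum a P Q hu hv hρ.le hρ' huv hτ (fun i hi => hI i (hP hi))
      (fun i hi => hJ i (hQ hi))
    rw [heq, norm_smul, Real.norm_eq_abs, abs_of_pos two_pos] at hdist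
    have h2 : ρ * (∑ i ∈ P, ‖a i‖ + ∑ i ∈ Q, ‖a i‖) < ρ * 1 := by linarith
    have h3 := lt_of_mul_lt_mul_left h2 hρ.le
    have hc : ∀ P : Finset ι, (#P : ℝ) ≤ ∑ i ∈ P, ‖a i‖ := fun P => by
      simpa using card_nsmul_le_sum P (fun i => ‖a i‖) 1 fun i _ => ha i
    have h4 : ((#P + #Q : ℕ) : ℝ) < 1 := by
      push_cast
      linarith [hc P, hc Q]
    have h5 : #P + #Q < 1 := by exact_mod_cast h4
    exact ⟨card_eq_zero.1 (by omega), card_eq_zero.1 (by omega)⟩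
  have hfin : S' \ S = ∅ → S \ S' = ∅ → S = S' := fun h1 h2 =>
    (sdiff_eq_empty_iff_subset.1 h2).antisymm (sdiff_eq_empty_iff_subset.1 h1)
  have hdiff := signedSum_sub a S S'
  rw [← two_smul ℝ] at hdiff
  -- Two sums in the ball differ by less than `2 * ρ`. If the traces on `I` and `J` grow in the same
  -- direction, the difference is twice a sum over both parts (`τ = 1`); if in opposite directions,
  -- the part in `J` is subtracted (`τ = -1`).
  rcases hSJ with hSJ | hSJ
  · have hmJ : ∀ x ∈ J, x ∈ S → x ∈ S' := fun x hx hxS =>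
      (mem_inter.1 (hSJ (mem_inter.2 ⟨hxS, hx⟩))).1
    have hsub : S \ S' = ∅ := sdiff_eq_empty_iff_subset.2 fun x hx => by
      by_cases hxI : x ∈ I
      · exact hmI x hxI hx
      by_cases hxJ : x ∈ J
      · exact hmJ x hxJ hx
      · exact (hmem x hxI hxJ).1 hx
    have hunion : S' \ S = ((S' \ S) ∩ I) ∪ ((S' \ S) ∩ J) := by
      ext x
      have := hmem x
      simp only [mem_union, mem_inter, Finset.mem_sdiff]
      tauto
    have hdisj : Disjoint ((S' \ S) ∩ I) ((S' \ S) ∩ J) :=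
      hIJ.mono inter_subset_right inter_subset_right
    obtain ⟨h1, h2⟩ := hsum ((S' \ S) ∩ I) ((S' \ S) ∩ J) 1 inter_subset_right inter_subset_right
      (by simp) (by
        rw [one_smul, ← sum_union hdisj, ← hunion, hdiff, hsub]; simp)
    refine hfin ?_ hsub
    rw [hunion, h1, h2, empty_union]
  · have hmJ : ∀ x ∈ J, x ∈ S' → x ∈ S := fun x hx hxS =>
      (mem_inter.1 (hSJ (mem_inter.2 ⟨hxS, hx⟩))).1
    obtain ⟨h1, h2⟩ := hsum (S' \ S) (S \ S') (-1)
      (fun x hx => by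
        have := hmem x
        have := hmJ x
        rw [Finset.mem_sdiff] at hx
        tauto)
      (fun x hx => by
        have := hmem x
        have := hmI x
        rw [Finset.mem_sdiff] at hx
        tauto)
      (by simp) (by rw [hdiff, neg_one_smul, ← sub_eq_add_neg])
    exact hfin h1 h2

end Cones

/-! ### From the product measure to counting sign choices. -/

section Probability

open Finset

/-- On boxes this is the expansion of `∏ i, (x i + y i)` over subsets. -/
lemma pi_Ber_eq (n : ℕ) :
    Measure.pi (fun _ : Fin n => Ber) =
      ∑ S : Finset (Fin n), (2⁻¹ : ℝ≥0∞) ^ n •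
        Measure.dirac (fun i => if i ∈ S then (1 : ℝ) else -1) := by
  classical
  refine Measure.pi_eq fun s hs => ?_
  have h1 : ∀ i, Ber (s i) = (2⁻¹ : ℝ≥0∞) * (s i).indicator 1 1 +
      (2⁻¹ : ℝ≥0∞) * (s i).indicator 1 (-1) := fun i => by
    simp [Ber, Measure.dirac_apply]
  simp_rw [h1]
  rw [Fintype.prod_add, Measure.finsetSum_apply]
  refine sum_congr rfl fun S _ => ?_
  have h2 : (Set.pi Set.univ s).indicator (1 : (Fin n → ℝ) → ℝ≥0∞)
      (fun i => if i ∈ S then (1 : ℝ) else -1) =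
      ∏ i, (s i).indicator 1 (if i ∈ S then (1 : ℝ) else -1) := by
    simp [Set.indicator_apply, Finset.prod_ite_zero, Set.mem_pi]
  rw [Measure.smul_apply, Measure.dirac_apply, h2, ← prod_mul_prod_compl S, smul_eq_mul,
    prod_mul_distrib, prod_mul_distrib, prod_const, prod_const,
    prod_congr (s₁ := S) rfl fun i hi => by rw [if_pos hi],
    prod_congr (s₁ := Sᶜ) rfl fun i hi => by rw [if_neg (mem_compl.1 hi)]]
  have h3 : (2⁻¹ : ℝ≥0∞) ^ n = 2⁻¹ ^ #S * 2⁻¹ ^ #Sᶜ := by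
    rw [← pow_add, card_add_card_compl, Fintype.card_fin]
  rw [h3]
  ring

variable {d n : ℕ}

lemma pi_Ber_apply (a : Fin n → EuclideanSpace ℝ (Fin d)) (B : Set (EuclideanSpace ℝ (Fin d))) :
    Measure.pi (fun _ : Fin n => Ber) {t | ∑ i, t i • a i ∈ B} =
      (2⁻¹ : ℝ≥0∞) ^ n * signCount a B := by
  classical
  have h (S : Finset (Fin n)) :
      ∑ i, (if i ∈ S then (1 : ℝ) else -1) • a i = signedSum a S := by
    refine sum_congr rfl fun i _ => ?_
    by_cases hi : i ∈ S <;> simp [hi]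
  rw [pi_Ber_eq, Measure.finsetSum_apply]
  simp only [Measure.smul_apply, Measure.dirac_apply, smul_eq_mul, ← mul_sum]
  congr 1
  simp only [Set.indicator_apply, Set.mem_ofPred_eq, h, Pi.one_apply]
  rw [sum_boole, signCount]

lemma maxSmallBallProb_toReal_le
    {B : EuclideanSpace ℝ (Fin d) → ℝ → Set (EuclideanSpace ℝ (Fin d))} {R K : ℝ} (hK : 0 ≤ K)
    (h : ∀ a : Fin n → EuclideanSpace ℝ (Fin d), (∀ i, 1 ≤ ‖a i‖) → ∀ x,
      (signCount a (B x R) : ℝ) ≤ 2 ^ n * K) :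
    (maxSmallBallProb d B R Ber n).toReal ≤ K := by
  refine ENNReal.toReal_le_of_le_ofReal hK (iSup₂_le fun a ha => iSup_le fun x => ?_)
  rw [pi_Ber_apply, ← ENNReal.inv_pow, mul_comm, ← div_eq_mul_inv]
  refine ENNReal.div_le_of_le_mul' ?_
  have := ENNReal.ofReal_le_ofReal (h a ha x)
  rwa [ENNReal.ofReal_natCast, ENNReal.ofReal_mul (by positivity), ENNReal.ofReal_pow (by norm_num),
    ENNReal.ofReal_ofNat] at this

lemma maxSmallBallProb_le_one
    (B : EuclideanSpace ℝ (Fin d) → ℝ → Set (EuclideanSpace ℝ (Fin d))) (R : ℝ) :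
    maxSmallBallProb d B R Ber n ≤ 1 :=
  iSup₂_le fun _ _ => iSup_le fun _ => prob_le_one

lemma signCount_le_maxSmallBallProb
    (B : EuclideanSpace ℝ (Fin d) → ℝ → Set (EuclideanSpace ℝ (Fin d))) (R : ℝ)
    (a : Fin n → EuclideanSpace ℝ (Fin d)) (ha : ∀ i, 1 ≤ ‖a i‖) (x : EuclideanSpace ℝ (Fin d)) :
    (signCount a (B x R) : ℝ) / 2 ^ n ≤ (maxSmallBallProb d B R Ber n).toReal := by
  have h1 : (2⁻¹ : ℝ≥0∞) ^ n * signCount a (B x R) ≤ maxSmallBallProb d B R Ber n := by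
    rw [← pi_Ber_apply]
    exact (le_iSup (fun x => Measure.pi (fun _ : Fin n => Ber) {t | ∑ i, t i • a i ∈ B x R}) x).trans
      (le_iSup₂ (f := fun (a : Fin n → EuclideanSpace ℝ (Fin d)) (_ : ∀ i, 1 ≤ ‖a i‖) =>
        smallBallProb B R Ber a) a ha)
  have h2 := ENNReal.toReal_mono
    (ne_top_of_le_ne_top ENNReal.one_ne_top (maxSmallBallProb_le_one B R)) h1
  simp only [ENNReal.toReal_mul, ENNReal.toReal_pow, ENNReal.toReal_inv, ENNReal.toReal_ofNat,
    ENNReal.toReal_natCast] at h2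
  rwa [inv_pow, mul_comm, ← div_eq_mul_inv] at h2

end Probability

/-! ### Central binomial probabilities and their asymptotics. -/

section Binomial

open Finset Topology

/-- The largest probability of the binomial distribution with parameters `n` and `1 / 2`. -/
noncomputable def midProb (n : ℕ) : ℝ := (n.choose (n / 2) : ℝ) / 2 ^ n

lemma midProb_pos (n : ℕ) : 0 < midProb n :=
  div_pos (by exact_mod_cast Nat.choose_pos (Nat.div_le_self n 2)) (by positivity)

lemma midProb_odd (k : ℕ) :
    midProb (2 * k + 1) = midProb (2 * k) * ((2 * k + 1) / (2 * (k + 1))) := by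
  have h := Nat.add_one_mul_choose_eq (2 * k) k
  rw [Nat.choose_symm_of_eq_add (show 2 * k + 1 = (k + 1) + k by ring)] at h
  have h' : (2 * k + 1 : ℝ) * (2 * k).choose k = (2 * k + 1).choose k * (k + 1) := by
    exact_mod_cast h
  unfold midProb
  rw [show (2 * k + 1) / 2 = k by omega, show 2 * k / 2 = k by omega, pow_succ]
  field_simp
  linarith

lemma midProb_even (k : ℕ) : midProb (2 * k + 2) = midProb (2 * k + 1) := by
  have h := Nat.choose_succ_succ (2 * k + 1) k
  rw [Nat.succ_eq_add_one, Nat.succ_eq_add_one,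
    Nat.choose_symm_of_eq_add (show 2 * k + 1 = (k + 1) + k by ring)] at h
  unfold midProb
  rw [show (2 * k + 2) / 2 = k + 1 by omega, show (2 * k + 1) / 2 = k by omega,
    show 2 * k + 2 = 2 * k + 1 + 1 by ring, h, pow_succ]
  push_cast
  field_simp
  ring

/-- Together with `antitone_mul_midProb_sq` this pins `midProb n` to order `n ^ (-1/2)` without
Stirling. The factor `(n + 1) / 2` is `⌈n / 2⌉`, which, like `midProb`, does not change from `2 * k
+ 1` to `2 * k + 2`. -/
lemma monotone_mul_midProb_sq : Monotone fun n : ℕ => (((n + 1) / 2 : ℕ) : ℝ) * midProb n ^ 2 := by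
  refine monotone_nat_of_le_succ fun n => ?_
  obtain ⟨k, rfl | rfl⟩ := Nat.even_or_odd' n
  · rw [midProb_odd, show (2 * k + 1) / 2 = k by omega, show (2 * k + 1 + 1) / 2 = k + 1 by omega,
      mul_pow, mul_left_comm, mul_comm]
    refine mul_le_mul_of_nonneg_left ?_ (sq_nonneg _)
    push_cast
    rw [div_pow, mul_div_assoc', le_div_iff₀ (by positivity)]
    nlinarith [Nat.cast_nonneg (α := ℝ) k]
  · rw [midProb_even, show (2 * k + 1 + 1 + 1) / 2 = (2 * k + 1 + 1) / 2 by omega]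

lemma antitone_mul_midProb_sq :
    Antitone fun n : ℕ => (2 * (((n + 1) / 2 : ℕ) : ℝ) + 1) * midProb n ^ 2 := by
  refine antitone_nat_of_succ_le fun n => ?_
  obtain ⟨k, rfl | rfl⟩ := Nat.even_or_odd' n
  · rw [midProb_odd, show (2 * k + 1) / 2 = k by omega, show (2 * k + 1 + 1) / 2 = k + 1 by omega,
      mul_pow, mul_left_comm, mul_comm (2 * (k : ℝ) + 1)]
    refine mul_le_mul_of_nonneg_left ?_ (sq_nonneg _)
    push_cast
    rw [div_pow, mul_div_assoc', div_le_iff₀ (by positivity)]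
    nlinarith [Nat.cast_nonneg (α := ℝ) k]
  · rw [midProb_even, show (2 * k + 1 + 1 + 1) / 2 = (2 * k + 1 + 1) / 2 by omega]

lemma mul_midProb_sq_le_one (n : ℕ) : n * midProb n ^ 2 ≤ 1 := by
  have h := antitone_mul_midProb_sq (Nat.zero_le n)
  simp only [midProb] at h
  norm_num at h
  refine le_trans ?_ h
  rw [midProb]
  gcongr
  have : n ≤ 2 * ((n + 1) / 2) + 1 := by omega
  exact_mod_cast this

/-- Compares `midProb m` with `midProb n` with the sharp constant as `m / n → 1`, which the factor
`1 + o(1)` requires. -/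
lemma mul_midProb_sq_le {m n : ℕ} (h : m ≤ n) :
    m * midProb m ^ 2 ≤ (n + 1) * midProb n ^ 2 := by
  have h1 := monotone_mul_midProb_sq h
  simp only at h1
  have h2 : (m : ℝ) ≤ 2 * (((m + 1) / 2 : ℕ) : ℝ) := by
    have : m ≤ 2 * ((m + 1) / 2) := by omega
    exact_mod_cast this
  have h3 : 2 * (((n + 1) / 2 : ℕ) : ℝ) ≤ n + 1 := by
    have : 2 * ((n + 1) / 2) ≤ n + 1 := by omega
    exact_mod_cast this
  nlinarith [mul_le_mul_of_nonneg_right h2 (sq_nonneg (midProb m)),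
    mul_le_mul_of_nonneg_right h3 (sq_nonneg (midProb n))]

/-- Consecutive ratios are `(n - n / 2 - j) / (n / 2 + j + 1)`, which tend to `1` for fixed `j`. -/
lemma tendsto_choose_ratio (j : ℕ) :
    Tendsto (fun n : ℕ => (n.choose (n / 2 + j) : ℝ) / n.choose (n / 2)) atTop (𝓝 1) := by
  induction j with
  | zero =>
    refine tendsto_const_nhds.congr fun n => ?_
    have : (0 : ℝ) < n.choose (n / 2) := by exact_mod_cast Nat.choose_pos (Nat.div_le_self n 2)
    rw [add_zero, div_self this.ne']
  | succ j ih =>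
    have hlim : Tendsto (fun n : ℕ => ((n : ℝ) - (n / 2 + j : ℕ)) / ((n / 2 + j : ℕ) + 1))
        atTop (𝓝 1) := by
      have h1 : Tendsto (fun n : ℕ => (2 * j + 1 : ℝ) / ((n / 2 + j : ℕ) + 1)) atTop (𝓝 0) := by
        refine tendsto_const_nhds.div_atTop (tendsto_atTop_add_const_right _ _ ?_)
        exact tendsto_natCast_atTop_atTop.comp (tendsto_atTop_mono
          (fun n => Nat.le_add_right _ j) (Nat.tendsto_div_const_atTop two_ne_zero))
      refine tendsto_of_tendsto_of_tendsto_of_le_of_le (g := fun n : ℕ =>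
        1 - (2 * j + 1 : ℝ) / ((n / 2 + j : ℕ) + 1)) (h := fun _ => 1)
        (by simpa using tendsto_const_nhds.sub h1) tendsto_const_nhds (fun n => ?_) fun n => ?_
      · have h2 : ((2 * (n / 2) : ℕ) : ℝ) ≤ n := by exact_mod_cast Nat.mul_div_le n 2
        push_cast at h2 ⊢
        have : (0 : ℝ) < (n / 2 : ℕ) + j + 1 := by positivity
        rw [one_sub_div this.ne']
        exact div_le_div_of_nonneg_right (by linarith) this.le
      · have h2 : (n : ℝ) ≤ ((2 * (n / 2) + 1 : ℕ) : ℝ) := by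
          have : n ≤ 2 * (n / 2) + 1 := by omega
          exact_mod_cast this
        push_cast at h2 ⊢
        have : (0 : ℝ) < (n / 2 : ℕ) + j + 1 := by positivity
        rw [div_le_one this]
        linarith [Nat.cast_nonneg (α := ℝ) j]
    have := ih.mul hlim
    rw [one_mul] at this
    refine this.congr' ?_
    filter_upwards [eventually_ge_atTop (2 * j)] with n hn
    have h := Nat.choose_succ_right_eq n (n / 2 + j)
    have hle : n / 2 + j ≤ n := by omega
    have h' : (n.choose (n / 2 + (j + 1)) : ℝ) * ((n / 2 + j : ℕ) + 1) =
        n.choose (n / 2 + j) * ((n : ℝ) - (n / 2 + j : ℕ)) := by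
      rw [← Nat.cast_sub hle]
      exact_mod_cast h
    have : (0 : ℝ) < n.choose (n / 2) := by exact_mod_cast Nat.choose_pos (Nat.div_le_self n 2)
    rw [div_mul_div_comm, div_eq_div_iff (by positivity) this.ne', ← h']
    ring

/-- A function that is bounded below by the sum of `s` consecutive central binomial probabilities
and asymptotically bounded above by `s` times the largest one is equivalent to the latter. -/
lemma isEquivalent_midProb {f : ℕ → ℝ} {s : ℕ} (hs : 1 ≤ s)
    (hlow : ∀ᶠ n : ℕ in atTop, (∑ j ∈ range s, (n.choose (n / 2 + j) : ℝ)) / 2 ^ n ≤ f n)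
    (hup : ∀ c : ℝ, 1 < c → ∀ᶠ n : ℕ in atTop, f n ≤ c * (s * midProb n)) :
    f ~[atTop] fun n => s * midProb n := by
  have hs' : (0 : ℝ) < s := by exact_mod_cast hs
  have hpos (n : ℕ) : 0 < s * midProb n := mul_pos hs' (midProb_pos n)
  refine isEquivalent_of_tendsto_one ?_
  have hl : Tendsto (fun n : ℕ => (∑ j ∈ range s, (n.choose (n / 2 + j) : ℝ)) / 2 ^ n /
      (s * midProb n)) atTop (𝓝 1) := by
    have h1 := (tendsto_finsetSum (range s) fun j _ => tendsto_choose_ratio j).div_const (s : ℝ)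
    simp only [sum_const, card_range, nsmul_eq_mul, mul_one, div_self hs'.ne'] at h1
    refine h1.congr fun n => ?_
    have : (0 : ℝ) < n.choose (n / 2) := by exact_mod_cast Nat.choose_pos (Nat.div_le_self n 2)
    rw [← sum_div, midProb]
    field_simp
  refine tendsto_order.2 ⟨fun b hb => ?_, fun b hb => ?_⟩
  · filter_upwards [hlow, (tendsto_order.1 hl).1 b hb] with n h1 h2
    exact h2.trans_le (div_le_div_of_nonneg_right h1 (hpos n).le)
  · filter_upwards [hup ((1 + b) / 2) (by linarith)] with n h1
    rw [Pi.div_apply, div_lt_iff₀ (hpos n)]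
    exact h1.trans_lt (mul_lt_mul_of_pos_right (by linarith) (hpos n))

lemma sumLargestChoose_le (n s : ℕ) : sumLargestChoose n s ≤ s * n.choose (n / 2) := by
  refine Finset.sup_le fun I hI => ?_
  rw [mem_filter] at hI
  refine (sum_le_card_nsmul I _ _ fun i _ => Nat.choose_le_middle i n).trans ?_
  exact Nat.mul_le_mul_right _ hI.2

lemma le_sumLargestChoose {n s : ℕ} (h : 2 * s ≤ n) :
    ∑ j ∈ range s, n.choose (n / 2 + j) ≤ sumLargestChoose n s := by
  have hsum : ∑ j ∈ range s, n.choose (n / 2 + j) =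
      ∑ i ∈ (range s).map (addLeftEmbedding (n / 2)), n.choose i := by simp
  rw [hsum]
  refine Finset.le_sup (f := fun I => ∑ i ∈ I, n.choose i) ?_
  simp only [mem_filter, mem_powerset, card_map, card_range, le_refl, and_true]
  intro i hi
  simp only [Finset.mem_map, mem_range, addLeftEmbedding_apply] at hi ⊢
  omega

lemma isEquivalent_sumLargestChoose {s : ℕ} (hs : 1 ≤ s) :
    (fun n : ℕ => ((2 : ℝ) ^ n)⁻¹ * (sumLargestChoose n s : ℝ)) ~[atTop]
      fun n => s * midProb n := by
  refine isEquivalent_midProb hs ?_ fun c hc => Eventually.of_forall fun n => ?_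
  · filter_upwards [eventually_ge_atTop (2 * s)] with n hn
    rw [inv_mul_eq_div]
    gcongr
    exact_mod_cast le_sumLargestChoose hn
  · have h1 : (sumLargestChoose n s : ℝ) ≤ s * n.choose (n / 2) := by
      exact_mod_cast sumLargestChoose_le n s
    have h2 : ((2 : ℝ) ^ n)⁻¹ * (sumLargestChoose n s : ℝ) ≤ s * midProb n := by
      rw [inv_mul_eq_div, midProb, mul_div_assoc']
      gcongr
    nlinarith [midProb_pos n, mul_nonneg (Nat.cast_nonneg (α := ℝ) s) (midProb_pos n).le]

end Binomial

/-! ### The upper bound: one dominant direction or two popular cones. -/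

section UpperBound

open Finset

lemma cast_choose_mul_two_pow {N m : ℕ} (h : m ≤ N) :
    (((m.choose (m / 2)) * 2 ^ (N - m) : ℕ) : ℝ) = 2 ^ N * midProb m := by
  obtain ⟨k, rfl⟩ := Nat.exists_eq_add_of_le h
  rw [Nat.add_sub_cancel_left, midProb, pow_add]
  push_cast
  field_simp

variable {ι E : Type*} [Fintype ι] [DecidableEq ι] [NormedAddCommGroup E] [InnerProductSpace ℝ E]

/-- Projection to the line spanned by `u` sends the ball into an interval of half-length `R`, where
the Erdős bound applies. -/
lemma signCount_closedBall_le_of_inner (a : ι → E) (I : Finset ι) {u : E} (hu : ‖u‖ = 1)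
    {c R : ℝ} {s : ℕ} (hI : ∀ i ∈ I, c ≤ |inner ℝ u (a i)|) (hc : 0 < c) (hR : R < c * s) (x : E) :
    (signCount a (Metric.closedBall x R) : ℝ) ≤ 2 ^ Fintype.card ι * (s * midProb #I) := by
  classical
  have h1 : signCount a (Metric.closedBall x R) ≤ signCount (fun i => inner ℝ u (a i))
      (Set.Icc (inner ℝ u x - R) (inner ℝ u x + R)) := by
    refine card_le_card fun S hS => ?_
    simp only [mem_filter, mem_univ, true_and, Metric.mem_closedBall, dist_eq_norm] at hS ⊢
    have h2 : signedSum (fun i => inner ℝ u (a i)) S = inner ℝ u (signedSum a S) := by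
      rw [signedSum, signedSum, inner_sum]
      refine sum_congr rfl fun i _ => ?_
      split_ifs <;> simp
    have h3 : |inner ℝ u (signedSum a S - x)| ≤ R :=
      (abs_real_inner_le_norm u _).trans (by rwa [hu, one_mul])
    rw [inner_sub_right, abs_le] at h3
    rw [h2]
    exact ⟨by linarith [h3.1], by linarith [h3.2]⟩
  have h2 := h1.trans (signCount_Icc_le _ I hI hc hR)
  have h3 : (signCount a (Metric.closedBall x R) : ℝ) ≤
      ((s * ((#I).choose (#I / 2) * 2 ^ (Fintype.card ι - #I)) : ℕ) : ℝ) := by exact_mod_cast h2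
  rw [Nat.cast_mul, cast_choose_mul_two_pow (card_le_univ I)] at h3
  linarith

/-- Covering the ball about `0` and translating makes the number of small balls independent of `x`.
-/
lemma exists_forall_closedBall_subset [FiniteDimensional ℝ E] (R : ℝ) {ρ : ℝ} (hρ : 0 < ρ) :
    ∃ T : Finset E, ∀ x : E,
      Metric.closedBall x R ⊆ ⋃ z ∈ T, Metric.ball (x + z) ρ := by
  have := FiniteDimensional.proper_real E
  obtain ⟨t, -, ht, hcov⟩ := (isCompact_closedBall (0 : E) R).finite_cover_balls hρ
  refine ⟨ht.toFinset, fun x y hy => ?_⟩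
  have := hcov (show y - x ∈ Metric.closedBall 0 R by simpa [dist_eq_norm] using hy)
  simp only [Set.mem_iUnion, exists_prop, Metric.mem_ball, Set.Finite.mem_toFinset] at this ⊢
  obtain ⟨z, hz, hyz⟩ := this
  refine ⟨z, hz, ?_⟩
  rwa [dist_eq_norm, ← sub_sub, ← dist_eq_norm]

lemma exists_finset_cone_cover (E : Type*) [NormedAddCommGroup E] [InnerProductSpace ℝ E]
    [FiniteDimensional ℝ E] {ρ : ℝ} (hρ : 0 < ρ) :
    ∃ T : Finset E, (∀ u ∈ T, ‖u‖ = 1) ∧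
      ∀ v : E, v ≠ 0 → ∃ u ∈ T, ‖v - ‖v‖ • u‖ ≤ ρ * ‖v‖ := by
  have := FiniteDimensional.proper_real E
  obtain ⟨t, hsub, ht, hcov⟩ := (isCompact_sphere (0 : E) 1).finite_cover_balls hρ
  refine ⟨ht.toFinset, fun u hu => by simpa using hsub ((ht.mem_toFinset).1 hu), fun v hv => ?_⟩
  have hv' : 0 < ‖v‖ := norm_pos_iff.2 hv
  have := hcov (show ‖v‖⁻¹ • v ∈ Metric.sphere 0 1 by
    simp [norm_smul, inv_mul_cancel₀ hv'.ne'])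
  simp only [Set.mem_iUnion, exists_prop, Metric.mem_ball, dist_eq_norm] at this
  obtain ⟨u, hu, hvu⟩ := this
  refine ⟨u, ht.mem_toFinset.2 hu, ?_⟩
  have h1 : v - ‖v‖ • u = ‖v‖ • (‖v‖⁻¹ • v - u) := by
    rw [smul_sub, smul_inv_smul₀ hv'.ne']
  rw [h1, norm_smul, norm_norm, mul_comm]
  exact mul_le_mul_of_nonneg_right hvu.le hv'.le

/-- Either many of the vectors have a large component in a fixed direction, or the small ball
probability is governed by two large sets of vectors in well separated cones. -/
lemma exists_signCount_closedBall_le_or (E : Type*) [NormedAddCommGroup E] [InnerProductSpace ℝ E]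
    [FiniteDimensional ℝ E] {R : ℝ} (hR : 0 < R) {s : ℕ} (hs : R < s) :
    ∃ N M : ℕ, 0 < N ∧ ∀ (n : ℕ), 0 < n → ∀ (a : Fin n → E), (∀ i, 1 ≤ ‖a i‖) →
      ∃ K ≤ n, (∀ x, (signCount a (Metric.closedBall x R) : ℝ) ≤ 2 ^ n * (s * midProb K)) ∧
        (K < n → ∃ k l : ℕ, k ≤ n ∧ (n : ℝ) ≤ N * k ∧ (n - K : ℝ) ≤ N * l ∧
          ∀ x, (signCount a (Metric.closedBall x R) : ℝ) ≤
            2 ^ n * (M * (midProb k * midProb l))) := by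
  classical
  have hs0 : (0 : ℝ) < s := hR.trans hs
  have hRs : R / s < 1 := (div_lt_one hs0).2 hs
  have hRs0 : 0 < R / s := div_pos hR hs0
  -- With this `ρ`, `c = 1 - 4 * ρ = (1 + R / s) / 2`, so `c * s` is the midpoint of `R` and `s`.
  -- The spare `ρ` turns `c` into the bound `c + ρ = 1 - 3 * ρ` needed for the cone axes.
  set ρ : ℝ := (1 - R / s) / 8 with hρdef
  have hρ : 0 < ρ := by rw [hρdef]; linarith
  have hρ' : ρ ≤ 1 / 4 := by rw [hρdef]; linarith
  set c : ℝ := 1 - 4 * ρ with hcdef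
  have hc : 0 < c := by rw [hcdef, hρdef]; linarith
  have hRc : R < c * s := by
    rw [← div_lt_iff₀ hs0, hcdef, hρdef]; linarith
  obtain ⟨T, hT1, hT⟩ := exists_finset_cone_cover E hρ
  obtain ⟨Z, hZ⟩ := exists_forall_closedBall_subset (E := E) R hρ
  -- `#T + 1` instead of `#T` keeps `N` positive even if `E` is trivial and `T` is empty.
  refine ⟨#T + 1, #Z, by omega, fun n hn a ha => ?_⟩
  have ha0 : ∀ i, a i ≠ 0 := fun i h => by have := ha i; rw [h, norm_zero] at this; linarith
  choose u huT hu using fun i => hT (a i) (ha0 i)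
  have hTne : T.Nonempty := ⟨u ⟨0, hn⟩, huT _⟩
  have hTpos : (0 : ℝ) < #T := by exact_mod_cast hTne.card_pos
  have hpigeon : ∀ W : Finset (Fin n), ∃ v ∈ T, (#W : ℝ) ≤ #T * #{i ∈ W | u i = v} := fun W => by
    obtain ⟨v, hv, hle⟩ := exists_le_card_fiber_of_nsmul_le_card_of_maps_to (s := W) (t := T)
      (f := u) (b := (#W : ℝ) / #T) (fun i _ => huT i) hTne
      (by rw [nsmul_eq_mul, mul_div_cancel₀ _ hTpos.ne'])
    refine ⟨v, hv, ?_⟩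
    rwa [div_le_iff₀' hTpos] at hle
  obtain ⟨v, hv, hvcard⟩ := hpigeon univ
  set near : Finset (Fin n) := {i | c * ‖a i‖ ≤ |inner ℝ v (a i)|} with hnear
  have hnearcard : #near ≤ n := by simpa using card_le_univ near
  refine ⟨#near, hnearcard, fun x => ?_, fun hlt => ?_⟩
  · have := signCount_closedBall_le_of_inner a near (hT1 v hv) (c := c) (fun i hi => ?_) hc hRc x
    · simpa using this
    · exact le_trans (by nlinarith [ha i]) (mem_filter.1 hi).2
  obtain ⟨w, hw, hwcard⟩ := hpigeon nearᶜ
  set I : Finset (Fin n) := {i | u i = v} with hIdef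
  set J : Finset (Fin n) := {i ∈ nearᶜ | u i = w} with hJdef
  have hcompl : (#nearᶜ : ℝ) = n - #near := by
    rw [card_compl, Fintype.card_fin, Nat.cast_sub hnearcard]
  have hI : ∀ i ∈ I, ‖a i - ‖a i‖ • v‖ ≤ ρ * ‖a i‖ := fun i hi => by
    have := hu i
    rwa [(mem_filter.1 hi).2] at this
  have hJ : ∀ i ∈ J, ‖a i - ‖a i‖ • w‖ ≤ ρ * ‖a i‖ := fun i hi => by
    have := hu i
    rwa [(mem_filter.1 hi).2] at this
  have hJfar : ∀ i ∈ J, |inner ℝ v (a i)| < c * ‖a i‖ := fun i hi => by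
    simpa [hnear] using (mem_filter.1 hi).1
  have hinner : ∀ (i : Fin n) (z : E), ‖a i - ‖a i‖ • z‖ ≤ ρ * ‖a i‖ →
      ‖a i‖ * |inner ℝ v z| ≤ |inner ℝ v (a i)| + ρ * ‖a i‖ := fun i z hz => by
    have h1 : |inner ℝ v (a i - ‖a i‖ • z)| ≤ ρ * ‖a i‖ :=
      (abs_real_inner_le_norm v _).trans (by rwa [hT1 v hv, one_mul])
    rw [inner_sub_right, inner_smul_right] at h1
    have h2 := abs_sub_abs_le_abs_sub (‖a i‖ * inner ℝ v z) (inner ℝ v (a i))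
    rw [abs_sub_comm, abs_mul, abs_norm] at h2
    linarith
  -- A vector in the cone about `v` has component at least `(1 - ρ) * ‖a i‖ > c * ‖a i‖` along `v`,
  -- so it belongs to `near`.
  have hdisj : Disjoint I J := by
    rw [Finset.disjoint_left]
    intro i hi hi'
    have h1 := hinner i v (hI i hi)
    rw [real_inner_self_eq_norm_sq, hT1 v hv] at h1
    norm_num at h1
    nlinarith [hJfar i hi', ha i]
  have hJne : J.Nonempty := by
    rw [nonempty_iff_ne_empty]
    intro h0
    rw [h0, hcompl] at hwcard
    have : (#near : ℝ) < n := by exact_mod_cast hlt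
    simp at hwcard
    linarith
  -- Any one member of `J` witnesses the separation: it is within relative distance `ρ` of `w` and
  -- has component less than `c * ‖a i‖` along `v`.
  have hvw : |inner ℝ v w| ≤ 1 - 3 * ρ := by
    obtain ⟨i, hi⟩ := hJne
    have h1 := hinner i w (hJ i hi)
    have h2 := hJfar i hi
    refine le_of_mul_le_mul_left ?_ (lt_of_lt_of_le one_pos (ha i))
    rw [hcdef] at h2
    linarith
  refine ⟨#I, #J, by simpa using card_le_univ I, ?_, ?_, fun x => ?_⟩
  · rw [card_univ, Fintype.card_fin] at hvcard
    refine hvcard.trans (mul_le_mul_of_nonneg_right ?_ (Nat.cast_nonneg _))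
    push_cast; linarith
  · rw [← hcompl]
    refine hwcard.trans (mul_le_mul_of_nonneg_right ?_ (Nat.cast_nonneg _))
    push_cast; linarith
  · have h1 : signCount a (Metric.closedBall x R) ≤
        #Z * ((#I).choose (#I / 2) * (#J).choose (#J / 2) * 2 ^ (n - (#I + #J))) := by
      refine (signCount_iUnion_le a Z _ (hZ x)).trans
        ((sum_le_card_nsmul Z _ _ fun z _ => ?_).trans_eq (smul_eq_mul _ _))
      simpa using signCount_ball_le_of_cones a I J hdisj (hT1 v hv) (hT1 w hw) hρ hρ' hvw ha hI hJ
        (x + z)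
    have h2 : (signCount a (Metric.closedBall x R) : ℝ) ≤
        #Z * ((#I).choose (#I / 2) * (#J).choose (#J / 2) * 2 ^ (n - (#I + #J))) := by
      exact_mod_cast h1
    refine h2.trans_eq ?_
    have h3 : #I + #J ≤ n := by
      rw [← card_union_of_disjoint hdisj]
      simpa using card_le_univ (I ∪ J)
    have h4 : (2 : ℝ) ^ n = 2 ^ #I * 2 ^ #J * 2 ^ (n - (#I + #J)) := by
      rw [← pow_add, ← pow_add, Nat.add_sub_cancel' h3]
    rw [h4, midProb, midProb]
    field_simp

lemma eventually_signCount_closedBall_le (E : Type*) [NormedAddCommGroup E] [InnerProductSpace ℝ E]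
    [FiniteDimensional ℝ E] {R : ℝ} (hR : 0 < R) {s : ℕ} (hs : R < s) {c : ℝ} (hc : 1 < c) :
    ∀ᶠ n : ℕ in atTop, ∀ a : Fin n → E, (∀ i, 1 ≤ ‖a i‖) → ∀ x,
      (signCount a (Metric.closedBall x R) : ℝ) ≤ 2 ^ n * (c * (s * midProb n)) := by
  obtain ⟨N, M, hN, H⟩ := exists_signCount_closedBall_le_or E hR hs
  have hN' : (0 : ℝ) < N := by exact_mod_cast hN
  have hs1 : (1 : ℝ) ≤ s := by
    have : (0 : ℝ) < s := hR.trans hs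
    exact_mod_cast (show 0 < s by exact_mod_cast this)
  have hc0 : 0 < c := by linarith
  have hη : 0 < 1 - c⁻¹ := by linarith [inv_lt_one_of_one_lt₀ hc]
  -- The second threshold gives `n + 1 ≤ c * n`, absorbing the `+ 1` of `mul_midProb_sq_le`. The
  -- third forces `M ^ 2 * (2 * N) ≤ l` in the two-cone case.
  filter_upwards [eventually_gt_atTop 0,
    tendsto_natCast_atTop_atTop.eventually_ge_atTop (1 / (c - 1)),
    tendsto_natCast_atTop_atTop.eventually_ge_atTop ((M ^ 2 * (2 * N) * N : ℝ) / (1 - c⁻¹))]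
    with n hn h1 h2 a ha x
  have hn' : (1 : ℝ) ≤ n := by exact_mod_cast hn
  have hq := midProb_pos n
  obtain ⟨K, hKn, hA, hB⟩ := H n hn a ha
  -- If `K ≥ n / c`, then `n + 1 ≤ K * c ^ 2` and so `midProb K ≤ c * midProb n`. Otherwise `l` is
  -- at least a constant times `n`, and the extra factor `midProb l` beats all constants.
  rcases le_or_gt ((n : ℝ) / c) K with hK | hK
  · refine (hA x).trans ?_
    have hK' : midProb K ≤ c * midProb n := by
      refine le_of_sq_le_sq ?_ (by positivity)
      have h3 := mul_midProb_sq_le hKn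
      rw [div_le_iff₀ hc0] at hK
      rw [div_le_iff₀ (by linarith)] at h1
      have h4 : (n + 1 : ℝ) ≤ K * c ^ 2 := by nlinarith
      have hK0 : (0 : ℝ) < K := by nlinarith
      refine le_of_mul_le_mul_left ?_ hK0
      nlinarith [mul_le_mul_of_nonneg_right h4 (sq_nonneg (midProb n))]
    have : (s : ℝ) * midProb K ≤ c * (s * midProb n) := by nlinarith
    exact mul_le_mul_of_nonneg_left this (by positivity)
  · have hKn' : K < n := by
      have : (K : ℝ) < n := hK.trans_le (div_le_self (by linarith) hc.le)
      exact_mod_cast this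
    obtain ⟨k, l, hkn, hk, hl, hle⟩ := hB hKn'
    refine (hle x).trans (mul_le_mul_of_nonneg_left ?_ (by positivity))
    have hk0 : (0 : ℝ) < k := by
      by_contra! h
      nlinarith
    have hl' : n * (1 - c⁻¹) ≤ N * l := by
      rw [div_eq_mul_inv] at hK
      linarith
    have hl0 : (0 : ℝ) < l := by
      by_contra! h
      nlinarith [mul_pos (zero_lt_one.trans_le hn') hη]
    have h3 : midProb k ^ 2 ≤ 2 * N * midProb n ^ 2 := by
      refine le_of_mul_le_mul_left ((mul_midProb_sq_le hkn).trans ?_) hk0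
      rw [← mul_assoc]
      refine mul_le_mul_of_nonneg_right ?_ (sq_nonneg _)
      linarith
    have h4 : (M : ℝ) ^ 2 * (2 * N) * midProb l ^ 2 ≤ 1 := by
      rw [div_le_iff₀ hη] at h2
      have h5 : (M : ℝ) ^ 2 * (2 * N) * N ≤ N * l := h2.trans hl'
      have h6 : (M : ℝ) ^ 2 * (2 * N) ≤ l := by
        refine le_of_mul_le_mul_right ?_ hN'
        linarith
      exact (mul_le_mul_of_nonneg_right h6 (sq_nonneg _)).trans (mul_midProb_sq_le_one l)
    have h5 : (M : ℝ) * (midProb k * midProb l) ≤ midProb n := by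
      refine le_of_sq_le_sq ?_ hq.le
      calc ((M : ℝ) * (midProb k * midProb l)) ^ 2
          = M ^ 2 * midProb l ^ 2 * midProb k ^ 2 := by ring
        _ ≤ M ^ 2 * midProb l ^ 2 * (2 * N * midProb n ^ 2) :=
            mul_le_mul_of_nonneg_left h3 (by positivity)
        _ = (M ^ 2 * (2 * N) * midProb l ^ 2) * midProb n ^ 2 := by ring
        _ ≤ midProb n ^ 2 := mul_le_of_le_one_left (sq_nonneg _) h4
    have h6 : midProb n ≤ s * midProb n := le_mul_of_one_le_left hq.le hs1
    nlinarith [mul_pos (zero_lt_one.trans_le hs1) hq]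

end UpperBound

/-! ### The lower bound: equal unit vectors. -/

section LowerBound

open Finset

/-- For equal unit vectors, a ball of radius at least `s - 1` may contain the sums with
`n / 2, …, n / 2 + s - 1` positive signs. -/
lemma sum_choose_le_signCount {E : Type*} [NormedAddCommGroup E] [InnerProductSpace ℝ E]
    {e : E} (he : ‖e‖ = 1) (n s : ℕ) {B : E → Set E}
    (hB : ∀ x y : E, dist y x + 1 ≤ s → y ∈ B x) :
    ∃ x : E, ∑ j ∈ range s, n.choose (n / 2 + j) ≤ signCount (fun _ : Fin n => e) (B x) := by
  classical
  -- The sum with `i` plus signs is `(2 * i - n) • e`; the centre is the midpoint of those for `i =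
  -- n / 2` and `i = n / 2 + s - 1`.
  refine ⟨(2 * ((n / 2 : ℕ) : ℝ) + s - 1 - n) • e, ?_⟩
  have hsum : ∑ j ∈ range s, n.choose (n / 2 + j) =
      #((range s).biUnion fun j => powersetCard (n / 2 + j) (univ : Finset (Fin n))) := by
    rw [card_biUnion]
    · simp
    · intro i _ j _ hij
      exact (pairwise_disjoint_powersetCard univ) (by simpa using hij)
  rw [hsum]
  refine card_le_card fun S hS => ?_
  simp only [mem_biUnion, mem_range, mem_powersetCard_univ] at hS
  obtain ⟨j, hj, hcard⟩ := hS
  simp only [mem_filter, mem_univ, true_and]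
  apply hB
  have h1 : signedSum (fun _ : Fin n => e) S = (2 * (((n / 2 : ℕ) : ℝ) + j) - n) • e := by
    have h2 : ∀ i : Fin n, (if i ∈ S then e else -e) = (if i ∈ S then (2 : ℝ) • e else 0) - e := by
      intro i
      split_ifs
      · rw [two_smul, add_sub_cancel_right]
      · rw [zero_sub]
    simp_rw [signedSum, h2, sum_sub_distrib, sum_ite_mem, univ_inter, sum_const, hcard, card_univ,
      Fintype.card_fin, ← Nat.cast_smul_eq_nsmul ℝ, smul_smul, ← sub_smul]
    push_cast
    rw [mul_comm]
  rw [h1, dist_eq_norm, ← sub_smul, norm_smul, he, mul_one, Real.norm_eq_abs,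
    ← le_sub_iff_add_le, abs_le]
  have hj' : (j + 1 : ℝ) ≤ s := by exact_mod_cast hj
  constructor <;> linarith [Nat.cast_nonneg (α := ℝ) j]

end LowerBound

/-- Open and closed balls are treated together: the upper bound needs only `hle`, the lower bound
only `hge`. For open balls `hge` amounts to `⌊R⌋₊ < R`, which is where non-integrality of `R`
enters. -/
lemma isEquivalent_maxSmallBallProb {d : ℕ} (hd : 1 ≤ d) {R : ℝ} (hR : 0 < R)
    {B : EuclideanSpace ℝ (Fin d) → ℝ → Set (EuclideanSpace ℝ (Fin d))}
    (hle : ∀ x, B x R ⊆ Metric.closedBall x R)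
    (hge : ∀ x y : EuclideanSpace ℝ (Fin d), dist y x ≤ ⌊R⌋₊ → y ∈ B x R) :
    (fun n : ℕ => (maxSmallBallProb d B R Ber n).toReal) ~[atTop] fun n : ℕ =>
      ((2 : ℝ) ^ n)⁻¹ * (sumLargestChoose n (⌊R⌋₊ + 1) : ℝ) := by
  refine IsEquivalent.trans ?_ (isEquivalent_sumLargestChoose (Nat.le_add_left 1 _)).symm
  refine isEquivalent_midProb (Nat.le_add_left 1 _) (Eventually.of_forall fun n => ?_)
    fun c hc => ?_
  · have he : ‖(EuclideanSpace.single ⟨0, hd⟩ 1 : EuclideanSpace ℝ (Fin d))‖ = 1 := by simp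
    obtain ⟨x, hx⟩ := sum_choose_le_signCount he n (⌊R⌋₊ + 1) (B := fun x => B x R)
      fun x y h => hge x y (by push_cast at h; linarith)
    refine le_trans ?_ (signCount_le_maxSmallBallProb B R _ (fun _ => he.ge) x)
    gcongr
    exact_mod_cast hx
  · filter_upwards [eventually_signCount_closedBall_le (EuclideanSpace ℝ (Fin d)) hR
      (s := ⌊R⌋₊ + 1) (by exact_mod_cast Nat.lt_floor_add_one R) hc] with n hn
    refine maxSmallBallProb_toReal_le ?_ fun a ha x => le_trans ?_ (hn a ha x)
    · have := midProb_pos n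
      positivity
    · exact_mod_cast signCount_mono a (hle x)

end LittlewoodOfford

theorem mainTheorem2 (d : ℕ) (hd : 1 ≤ d) (R : ℝ) (hR : 0 < R) :
    ((fun n : ℕ => (LittlewoodOfford.maxSmallBallProb d Metric.closedBall R
          LittlewoodOfford.Ber n).toReal)
        ~[atTop] fun n : ℕ =>
          ((2 : ℝ) ^ n)⁻¹ * (LittlewoodOfford.sumLargestChoose n (⌊R⌋₊ + 1) : ℝ)) ∧
    ((∀ k : ℕ, R ≠ (k : ℝ)) →
      (fun n : ℕ => (LittlewoodOfford.maxSmallBallProb d Metric.ball R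
          LittlewoodOfford.Ber n).toReal)
        ~[atTop] fun n : ℕ =>
          ((2 : ℝ) ^ n)⁻¹ * (LittlewoodOfford.sumLargestChoose n (⌊R⌋₊ + 1) : ℝ)) := by
  refine ⟨LittlewoodOfford.isEquivalent_maxSmallBallProb hd hR (fun _ => subset_rfl)
    fun x y h => h.trans (Nat.floor_le hR.le), fun hk =>
    LittlewoodOfford.isEquivalent_maxSmallBallProb hd hR (fun _ => Metric.ball_subset_closedBall)
    fun x y h => h.trans_lt (lt_of_le_of_ne (Nat.floor_le hR.le) (hk _).symm)⟩
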